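/- **Definitions.** A *quasi \*-algebra with unit* $(\mathfrak A,\mathfrak A_0)$ consists of a complex vector space $\mathfrak A$ with a (conjugate-linear) involution $*$, a unital \*-algebra $\mathfrak A_0\subseteq\mathfrak A$ with unit $e$ whose involution is the restriction of $*$, and bilinear products $xa,\ ax\in\mathfrak A$ ($x\in\mathfrak A_0$, $a\in\mathfrak A$) extending the product of $\mathfrak A_0$, with $x_1(x_2a)=(x_1x_2)a$, $x_1(ax_2)=(x_1a)x_2$, $(ax)^*=x^*a^*$, $(xa)^*=a^*x^*$ and $ae=ea=a$. A *\*-representation* $\pi$ of $(\mathfrak A,\mathfrak A_0)$ is a linear map from $\mathfrak A$ into the linear operators $\mathcal D_\pi\to\mathcal H_\pi$, where $\mathcal D_\pi$ is a dense subspace of a complex Hilbert space $\mathcal H_\pi$, such that for all $a\in\mathfrak A$, $x\in\mathfrak A_0$: $\mathcal D_\pi$ is contained in the domain of $\pi(a)^*$ and $\pi(a^*)$ is the restriction $\pi(a)^\dagger$ of $\pi(a)^*$ to $\mathcal D_\pi$; $\pi(x)\mathcal D_\pi\subseteq\mathcal D_\pi$; and $\pi(ax)\xi=\pi(a)\pi(x)\xi$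 for $\xi\in\mathcal D_\pi$. Let $\mathrm{Rep}(\mathfrak A,\mathfrak A_0)$ be the family of all of them. Its *weak commutant* $\pi(\mathfrak A)'_{\rm w}$ is the set of bounded operators $X$ on $\mathcal H_\pi$ with $\langle \pi(a)\xi,X^*\eta\rangle=\langle X\xi,\pi(a^*)\eta\rangle$ for all $a\in\mathfrak A$, $\xi,\eta\in\mathcal D_\pi$. Let $\tau_{rep}$ be the locally convex topology on $\mathfrak A$ defined by the seminorms $a\mapsto\|\pi(a)\xi\|+\|\pi(a^*)\xi\|$, $\pi\in\mathrm{Rep}(\mathfrak A,\mathfrak A_0)$, $\xi\in\mathcal D_\pi$. $\mathfrak A_0$ has a *local structure* if there are an upward directed set $\mathcal F$ with a relation $\perp$ and a net $\{\mathfrak A_\alpha\}_{\alpha\in\mathcal F}$ of \*-subalgebras of $\mathfrak A_0$ containing $e$, each a C\*-algebra for a norm $\|\cdot\|_\alpha$, such that: every $\alpha$ has some $\beta$ with $\alpha\perp\beta$; $\alpha\le\beta$ and $\beta\perp\gamma$ imply $\alpha\perp\gamma$; if $\alpha\perp\beta$ and $\alpha\perp\gamma$ there is $\delta\ge\beta,\gamma$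 with $\alpha\perp\delta$; $\mathfrak A_0=\bigcup_\alpha\mathfrak A_\alpha$; $\mathfrak A_\beta\subseteq\mathfrak A_\alpha$ if $\beta\le\alpha$; $xy=yx$ for $x\in\mathfrak A_\alpha$, $y\in\mathfrak A_\beta$ if $\alpha\perp\beta$; and $\|x\|_\alpha=\|x\|_\beta$ for $x\in\mathfrak A_\alpha\cap\mathfrak A_\beta$. A linear functional $\omega:\mathfrak A\to\mathbb C$ is *representable* if (L1) $\omega(a^*a)\ge0$ for $a\in\mathfrak A_0$; (L2) $\omega(b^*x^*a)=\overline{\omega(a^*xb)}$ for $a,b\in\mathfrak A_0$, $x\in\mathfrak A$; (L3) for each $x\in\mathfrak A$ there is $\gamma_x>0$ with $|\omega(x^*a)|\le\gamma_x\,\omega(a^*a)^{1/2}$ for all $a\in\mathfrak A_0$. Let $\mathcal B(\mathfrak A)$ be the set of representable $\omega$ with $\omega(e)\le1$; a *state* is an element of $\mathcal E(\mathfrak A)=\{\omega\in\mathcal B(\mathfrak A):\omega(e)=1\}$. The *GNS representation* $\pi_\omega$ of a representable $\omega$ acts on the Hilbert space $\mathcal H_\omega$ obtained from $\mathfrak A_0$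 with the semi-inner product $\langle a,b\rangle=\omega(b^*a)$ by dividing out null vectors and completing. Let $\lambda_\omega:\mathfrak A_0\to\mathcal H_\omega$ be the canonical map, extended to $\mathfrak A$ by $\langle\lambda_\omega(a),\lambda_\omega(x)\rangle=\omega(x^*a)$ ($x\in\mathfrak A$, $a\in\mathfrak A_0$). The domain of $\pi_\omega$ is $\lambda_\omega(\mathfrak A_0)$, and $\pi_\omega(x)\lambda_\omega(a)=\lambda_\omega(xa)$. It belongs to $\mathrm{Rep}(\mathfrak A,\mathfrak A_0)$. Let $\mathfrak A^+$ be the $\tau_{rep}$-closure of $\{\sum_{k=1}^n x_k^*x_k: n\in\mathbb N,\ x_k\in\mathfrak A_0\}$, and write $\nu\le\omega$ if $(\omega-\nu)(a)\ge0$ for all $a\in\mathfrak A^+$. A state $\omega$ is *pure* if for every $\nu\in\mathcal B(\mathfrak A)$ with $0\le\nu\le\omega$ there is $\lambda\in[0,1]$ with $\nu=\lambda\omega$. **Theorem.** Let $(\mathfrak A,\mathfrak A_0)$ be a quasi \*-algebra with unit such that $\mathfrak A_0$ has a local structure. Assume that $\mathrm{Rep}(\mathfrak A,\mathfrak A_0)$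 is faithful (for each $a\ne0$ there is $\pi\in\mathrm{Rep}(\mathfrak A,\mathfrak A_0)$ with $\pi(a)\neq0$) and that $\mathfrak A_0$ is $\tau_{rep}$-dense in $\mathfrak A$. Let $\omega$ be a state. The following are equivalent: (i) $\omega$ is an extreme point of $\mathcal B(\mathfrak A)$; (ii) $\omega$ is a pure state; (iii) $\pi_\omega$ is quasi-irreducible, i.e. $\pi_\omega(\mathfrak A)'_{\rm w}=\mathbb C I$. -/

import Mathlib

open scoped ComplexOrder

universe u v w

namespace QuasiStar

/-- A quasi *-algebra `(A, A₀)` with unit: `A` is a complex vector space with an involution, `A₀` a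
unital *-algebra contained in `A` (through `ι`), `lmul x a` is the product `x a` and `rmul a x` the
product `a x`, for `x ∈ A₀` and `a ∈ A`. The unit `e` is `1 : A₀`. -/
class QuasiStarAlgebra (A₀ A : Type u) [Ring A₀] [StarRing A₀] [Algebra ℂ A₀] [StarModule ℂ A₀]
    [AddCommGroup A] [Module ℂ A] [StarAddMonoid A] [StarModule ℂ A] where
  ι : A₀ →ₗ[ℂ] A
  lmul : A₀ →ₗ[ℂ] A →ₗ[ℂ] A
  rmul : A →ₗ[ℂ] A₀ →ₗ[ℂ] A
  ι_injective : Function.Injective ι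
  lmul_ι : ∀ x y : A₀, lmul x (ι y) = ι (x * y)
  rmul_ι : ∀ x y : A₀, rmul (ι x) y = ι (x * y)
  lmul_lmul : ∀ (x y : A₀) (a : A), lmul x (lmul y a) = lmul (x * y) a
  lmul_rmul : ∀ (x y : A₀) (a : A), lmul x (rmul a y) = rmul (lmul x a) y
  star_ι : ∀ x : A₀, star (ι x) = ι (star x)
  star_rmul : ∀ (a : A) (x : A₀), star (rmul a x) = lmul (star x) (star a)
  star_lmul : ∀ (x : A₀) (a : A), star (lmul x a) = rmul (star a) (star x)
  one_lmul : ∀ a : A, lmul 1 a = a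
  rmul_one : ∀ a : A, rmul a 1 = a

/-- A local structure on `A₀`: an upward directed index set `F` with an orthogonality relation, and
a net of C*-algebras `B α` (with the unit of `A₀`), identified with their images in `A₀` under the
injective unital *-homomorphisms `incl α`. -/
structure LocalStructure (A₀ : Type u) [Ring A₀] [StarRing A₀] [Algebra ℂ A₀]
    (F : Type v) [Preorder F] where
  directed : IsDirectedOrder F
  perp : F → F → Prop
  exists_perp : ∀ α, ∃ β, perp α β
  perp_of_le : ∀ α β γ, α ≤ β → perp β γ → perp α γ
  exists_perp_upper : ∀ α β γ, perp α β → perp α γ → ∃ δ, perp α δ ∧ β ≤ δ ∧ γ ≤ δ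
  B : F → Type w
  [cstar : ∀ α, CStarAlgebra (B α)]
  incl : ∀ α, B α →⋆ₐ[ℂ] A₀
  incl_injective : ∀ α, Function.Injective (incl α)
  iUnion_range : ⋃ α, Set.range (incl α) = Set.univ
  range_mono : ∀ α β, β ≤ α → Set.range (incl β) ⊆ Set.range (incl α)
  comm_of_perp : ∀ α β, perp α β → ∀ (x : B α) (y : B β),
    incl α x * incl β y = incl β y * incl α x
  norm_eq : ∀ α β (x : B α) (y : B β), incl α x = incl β y → ‖x‖ = ‖y‖

section

variable (A₀ A : Type u) [Ring A₀] [StarRing A₀] [Algebra ℂ A₀] [StarModule ℂ A₀]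
  [AddCommGroup A] [Module ℂ A] [StarAddMonoid A] [StarModule ℂ A] [QuasiStarAlgebra A₀ A]

open QuasiStarAlgebra

/-- A *-representation of the quasi *-algebra `(A, A₀)` on a dense domain `D` of a Hilbert space
`H`. The field `adjoint` says that `D` lies in the domain of the adjoint of every `π a` and that
`π (star a) = (π a)†`, the restriction of that adjoint to `D`. As `π x` maps `D` into `D` for
`x ∈ A₀`, the weak product of `π a` and `π x` is the composition `π a ∘ π x`. -/
structure StarRep where
  H : Type u
  [normed : NormedAddCommGroup H]
  [inner : InnerProductSpace ℂ H]
  [complete : CompleteSpace H]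
  D : Submodule ℂ H
  dense : Dense (D : Set H)
  π : A →ₗ[ℂ] D →ₗ[ℂ] H
  adjoint : ∀ (a : A) (ξ η : D), Inner.inner ℂ (π a ξ) (η : H) = Inner.inner ℂ (ξ : H) (π (star a) η)
  invariant : ∀ (x : A₀) (ξ : D), π (ι x) ξ ∈ D
  map_rmul : ∀ (a : A) (x : A₀) (ξ : D), π (rmul a x) ξ = π a ⟨π (ι x) ξ, invariant x ξ⟩

attribute [instance] StarRep.normed StarRep.inner StarRep.complete

variable {A₀ A}

/-- The weak bounded commutant `π(A)'_w`; a bounded operator on the dense domain is identified with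
its continuous extension to the Hilbert space. -/
def StarRep.weakCommutant (ρ : StarRep A₀ A) : Set (ρ.H →L[ℂ] ρ.H) :=
  {X | ∀ (a : A) (ξ η : ρ.D),
    Inner.inner ℂ (ContinuousLinearMap.adjoint X (η : ρ.H)) (ρ.π a ξ) =
      Inner.inner ℂ (ρ.π (star a) η) (X (ξ : ρ.H))}

/-- The weak commutant consists exactly of the multiples of the identity operator. -/
def StarRep.QuasiIrreducible (ρ : StarRep A₀ A) : Prop :=
  ρ.weakCommutant = {X | ∃ c : ℂ, X = c • ContinuousLinearMap.id ℂ ρ.H}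

/-- The seminorm `a ↦ ‖π(a) ξ‖ + ‖π(a*) ξ‖`. -/
noncomputable def StarRep.seminorm (ρ : StarRep A₀ A) (ξ : ρ.D) : Seminorm ℂ A :=
  Seminorm.of (fun a => ‖ρ.π a ξ‖ + ‖ρ.π (star a) ξ‖)
    (fun a b => by
      simp only [map_add, star_add, LinearMap.add_apply]
      linarith [norm_add_le (ρ.π a ξ) (ρ.π b ξ),
        norm_add_le (ρ.π (star a) ξ) (ρ.π (star b) ξ)])
    (fun c a => by
      simp only [map_smul, star_smul, LinearMap.smul_apply, norm_smul, norm_star]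
      ring)

variable (A₀ A)

/-- The locally convex topology on `A` defined by the seminorms `a ↦ ‖π(a) ξ‖ + ‖π(a*) ξ‖`, where
`π` runs through all *-representations of `(A, A₀)` and `ξ` through the domain of `π`. -/
noncomputable abbrev tauRep : TopologicalSpace A :=
  ⨅ i : Σ ρ : StarRep A₀ A, ρ.D,
    (i.1.seminorm i.2).toSeminormedAddCommGroup.toUniformSpace.toTopologicalSpace

/-- The family of all *-representations of `(A, A₀)` is faithful. -/
def RepFaithful : Prop :=
  ∀ a : A, a ≠ 0 → ∃ ρ : StarRep A₀ A, ρ.π a ≠ 0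

/-- `A₀` is dense in `A` for the topology `tauRep`. -/
def RepDense : Prop :=
  @Dense A (tauRep A₀ A) (Set.range (ι : A₀ →ₗ[ℂ] A))

/-- The sums `∑ xₖ* xₖ` with `xₖ ∈ A₀`. -/
def algPositive : Set A :=
  {a | ∃ (n : ℕ) (x : Fin n → A₀), a = ι (∑ k, star (x k) * x k)}

/-- The positive cone `A⁺`: the closure of the sums of squares for the topology `tauRep`. -/
def positiveCone : Set A :=
  @closure A (tauRep A₀ A) (algPositive A₀ A)

variable {A}

/-- Representable linear functionals: conditions (L1), (L2) and (L3). -/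
structure IsRepresentable (ω : A →ₗ[ℂ] ℂ) : Prop where
  nonneg : ∀ a : A₀, 0 ≤ ω (ι (star a * a))
  hermitian : ∀ (a b : A₀) (x : A),
    ω (lmul (star b) (rmul (star x) a)) = star (ω (lmul (star a) (rmul x b)))
  bounded : ∀ x : A, ∃ γ : ℝ, 0 < γ ∧ ∀ a : A₀,
    ‖ω (rmul (star x) a)‖ ≤ γ * Real.sqrt (ω (ι (star a * a))).re

/-- The order on functionals: `ν ≤ ω` if `ω - ν` is nonnegative on the positive cone of `A`. -/
def FunctionalLE (ν ω : A →ₗ[ℂ] ℂ) : Prop :=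
  ∀ a ∈ positiveCone A₀ A, 0 ≤ (ω - ν) a

variable (A)

/-- `B(A)`: the representable functionals with `ω(e) ≤ 1`. -/
def repBall : Set (A →ₗ[ℂ] ℂ) :=
  {ω | IsRepresentable A₀ ω ∧ ω (ι (1 : A₀)) ≤ 1}

/-- `E(A)`: the states, i.e. the representable functionals with `ω(e) = 1`. -/
def states : Set (A →ₗ[ℂ] ℂ) :=
  {ω | ω ∈ repBall A₀ A ∧ ω (ι (1 : A₀)) = 1}

/-- The pure states. -/
def pureStates : Set (A →ₗ[ℂ] ℂ) :=
  {ω | ω ∈ states A₀ A ∧ ∀ ν ∈ repBall A₀ A, FunctionalLE A₀ 0 ν → FunctionalLE A₀ ν ω →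
    ∃ t : ℝ, 0 ≤ t ∧ t ≤ 1 ∧ ν = (t : ℂ) • ω}

variable {A}

/-! ### The GNS representation of a representable functional -/

section GNS

variable {A₀} {ω : A →ₗ[ℂ] ℂ} (hω : IsRepresentable A₀ ω)

/-- The vector space `A₀`, which carries the semi-inner product `⟨a, b⟩ = ω(a* b)` (conjugate
linear in the first variable). -/
@[nolint unusedArguments]
def PreGNS (_hω : IsRepresentable A₀ ω) : Type u := A₀

instance : AddCommGroup (PreGNS hω) := inferInstanceAs (AddCommGroup A₀)

instance : Module ℂ (PreGNS hω) := inferInstanceAs (Module ℂ A₀)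

/-- The identity map from `A₀` to `PreGNS`. -/
def toPre : A₀ ≃ₗ[ℂ] PreGNS hω := LinearEquiv.refl ℂ A₀

theorem rmul_rmul (a : A) (x y : A₀) : rmul (rmul a x) y = rmul a (x * y) := by
  apply star_injective
  simp only [star_rmul, lmul_lmul, star_mul]

theorem IsRepresentable.conj_symm {ω : A →ₗ[ℂ] ℂ} (hω : IsRepresentable A₀ ω) (a b : A₀) :
    star (ω (ι (star b * a))) = ω (ι (star a * b)) := by
  have h := hω.hermitian b a (ι (1 : A₀))
  simp only [star_ι, star_one, rmul_ι, lmul_ι, one_mul] at h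
  exact h.symm

/-- The semi-inner product `⟨a, b⟩ = ω(a* b)`. -/
noncomputable abbrev preGNSCore : PreInnerProductSpace.Core ℂ (PreGNS hω) where
  inner a b := ω (ι (star ((toPre hω).symm a) * (toPre hω).symm b))
  conj_inner_symm a b := hω.conj_symm _ _
  re_inner_nonneg a := (Complex.nonneg_iff.mp (hω.nonneg _)).1
  add_left a b c := by simp [add_mul]
  smul_left a b c := by simp

noncomputable instance : SeminormedAddCommGroup (PreGNS hω) :=
  InnerProductSpace.Core.toSeminormedAddCommGroup (c := preGNSCore hω)

noncomputable instance : InnerProductSpace ℂ (PreGNS hω) :=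
  InnerProductSpace.ofCore (preGNSCore hω)

theorem preGNS_inner (a b : A₀) :
    Inner.inner ℂ (toPre hω a) (toPre hω b) = ω (ι (star a * b)) := rfl

theorem preGNS_norm (a : A₀) : ‖toPre hω a‖ = Real.sqrt (ω (ι (star a * a))).re := rfl

/-- The Hilbert space `H_ω`, the completion of `A₀` for the semi-inner product `ω(a* b)`. -/
abbrev GNSSpace : Type u := UniformSpace.Completion (PreGNS hω)

/-- The canonical map `A₀ → H_ω`. -/
noncomputable def toGNS : A₀ →ₗ[ℂ] GNSSpace hω :=
  (UniformSpace.Completion.toComplL (𝕜 := ℂ) (E := PreGNS hω)).toLinearMap ∘ₗ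
    (toPre hω).toLinearMap

theorem inner_toGNS (a b : A₀) :
    Inner.inner ℂ (toGNS hω a) (toGNS hω b) = ω (ι (star a * b)) :=
  UniformSpace.Completion.inner_coe (toPre hω a) (toPre hω b)

theorem norm_toGNS (a : A₀) : ‖toGNS hω a‖ = Real.sqrt (ω (ι (star a * a))).re :=
  UniformSpace.Completion.norm_coe (toPre hω a)

theorem denseRange_toGNS : DenseRange (toGNS hω) :=
  UniformSpace.Completion.denseRange_coe (α := PreGNS hω)

theorem ext_toGNS {v w : GNSSpace hω}
    (h : ∀ a, Inner.inner ℂ v (toGNS hω a) = Inner.inner ℂ w (toGNS hω a)) : v = w := by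
  refine ext_inner_right ℂ fun z => ?_
  refine (denseRange_toGNS hω).induction_on (p := fun z => Inner.inner ℂ v z = Inner.inner ℂ w z)
    z (isClosed_eq (by fun_prop) (by fun_prop)) h

theorem exists_gnsVec (x : A) :
    ∃ v : GNSSpace hω, ∀ a, Inner.inner ℂ v (toGNS hω a) = ω (rmul (star x) a) := by
  obtain ⟨γ, -, hγ⟩ := hω.bounded x
  let f : PreGNS hω →L[ℂ] ℂ :=
    (ω ∘ₗ rmul (star x) ∘ₗ (toPre hω).symm.toLinearMap).mkContinuous γ fun a => hγ _
  let g : GNSSpace hω →L[ℂ] ℂ := f.extend UniformSpace.Completion.toComplL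
  refine ⟨(InnerProductSpace.toDual ℂ (GNSSpace hω)).symm g, fun a => ?_⟩
  rw [InnerProductSpace.toDual_symm_apply]
  exact ContinuousLinearMap.extend_eq f UniformSpace.Completion.denseRange_coe
    (UniformSpace.Completion.isUniformInducing_coe _) (toPre hω a)

/-- The map `λ_ω : A → H_ω`: `gnsVec x` is the vector with `⟨gnsVec x, a⟩ = ω(x* a)` for all
`a ∈ A₀`. It extends the canonical map `A₀ → H_ω`. -/
noncomputable def gnsVec : A →ₗ[ℂ] GNSSpace hω where
  toFun x := (exists_gnsVec hω x).choose
  map_add' x y := ext_toGNS hω fun a => by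
    rw [inner_add_left, (exists_gnsVec hω (x + y)).choose_spec,
      (exists_gnsVec hω x).choose_spec, (exists_gnsVec hω y).choose_spec, star_add, map_add,
      LinearMap.add_apply, map_add]
  map_smul' c x := ext_toGNS hω fun a => by
    rw [inner_smul_left, (exists_gnsVec hω (c • x)).choose_spec,
      RingHom.id_apply, (exists_gnsVec hω x).choose_spec, star_smul, map_smul,
      LinearMap.smul_apply, map_smul]
    rfl

theorem inner_gnsVec (x : A) (a : A₀) :
    Inner.inner ℂ (gnsVec hω x) (toGNS hω a) = ω (rmul (star x) a) :=
  (exists_gnsVec hω x).choose_spec a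

theorem gnsVec_ι (b : A₀) : gnsVec hω (ι b) = toGNS hω b :=
  ext_toGNS hω fun a => by rw [inner_gnsVec, inner_toGNS, star_ι, rmul_ι]

theorem inner_gnsVec_rmul (x : A) (a b : A₀) :
    Inner.inner ℂ (gnsVec hω (rmul x b)) (toGNS hω a) = ω (lmul (star b) (rmul (star x) a)) := by
  rw [inner_gnsVec, star_rmul, lmul_rmul]

theorem gnsVec_rmul_eq_zero (x : A) (a : A₀) (ha : toGNS hω a = 0) :
    gnsVec hω (rmul x a) = 0 := by
  refine ext_toGNS hω fun b => ?_
  obtain ⟨γ, -, hγ⟩ := hω.bounded (star (lmul (star b) x))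
  have h := hγ a
  rw [← norm_toGNS hω, ha, norm_zero, mul_zero, star_star, norm_le_zero_iff] at h
  rw [inner_gnsVec_rmul, hω.hermitian, lmul_rmul, h, star_zero, inner_zero_left]

/-- The operator `π_ω(x)`, given on the domain `λ_ω(A₀)` by `π_ω(x) λ_ω(a) = λ_ω(x a)`. -/
noncomputable def gnsOp (x : A) : LinearMap.range (toGNS hω) →ₗ[ℂ] GNSSpace hω :=
  (LinearMap.ker (toGNS hω)).liftQ (gnsVec hω ∘ₗ rmul x)
      (fun a ha => gnsVec_rmul_eq_zero hω x a ha) ∘ₗ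
    (toGNS hω).quotKerEquivRange.symm.toLinearMap

theorem gnsOp_apply (x : A) (a : A₀) :
    gnsOp hω x ⟨toGNS hω a, LinearMap.mem_range_self _ a⟩ = gnsVec hω (rmul x a) := by
  have h : (toGNS hω).quotKerEquivRange.symm ⟨toGNS hω a, LinearMap.mem_range_self _ a⟩ =
      (LinearMap.ker (toGNS hω)).mkQ a := by
    rw [LinearEquiv.symm_apply_eq]
    rfl
  simp only [gnsOp, LinearMap.comp_apply, LinearEquiv.coe_coe, h]
  exact Submodule.liftQ_apply _ _ _

/-- The GNS representation `π_ω` of a representable functional `ω`. -/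
noncomputable def gnsRep : StarRep A₀ A where
  H := GNSSpace hω
  D := LinearMap.range (toGNS hω)
  dense := denseRange_toGNS hω
  π :=
    { toFun := gnsOp hω
      map_add' := fun x y => by
        ext ⟨_, a, rfl⟩
        simp [gnsOp_apply]
      map_smul' := fun c x => by
        ext ⟨_, a, rfl⟩
        simp [gnsOp_apply] }
  adjoint := by
    rintro x ⟨_, a, rfl⟩ ⟨_, b, rfl⟩
    change Inner.inner ℂ (gnsOp hω x _) (toGNS hω b) =
      Inner.inner ℂ (toGNS hω a) (gnsOp hω (star x) _)
    rw [gnsOp_apply, gnsOp_apply, inner_gnsVec_rmul, ← inner_conj_symm, inner_gnsVec_rmul,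
      star_star, hω.hermitian]
    rfl
  invariant := by
    rintro x ⟨_, a, rfl⟩
    change gnsOp hω (ι x) _ ∈ _
    rw [gnsOp_apply, rmul_ι, gnsVec_ι]
    exact LinearMap.mem_range_self _ _
  map_rmul := by
    rintro x y ⟨_, a, rfl⟩
    change gnsOp hω (rmul x y) _ = gnsOp hω x ⟨gnsOp hω (ι y) _, _⟩
    have h : gnsOp hω (ι y) ⟨toGNS hω a, LinearMap.mem_range_self _ a⟩ = toGNS hω (y * a) := by
      rw [gnsOp_apply, rmul_ι, gnsVec_ι]
    simp only [h, gnsOp_apply, rmul_rmul]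

/-- The ultra-cyclic vector `ξ_ω = λ_ω(e)`. -/
noncomputable def gnsCyclic : (gnsRep hω).D :=
  (⟨toGNS hω 1, LinearMap.mem_range_self _ 1⟩ : LinearMap.range (toGNS hω))

theorem gnsRep_cyclic (x : A) : (gnsRep hω).π x (gnsCyclic hω) = gnsVec hω x := by
  change gnsOp hω x ⟨toGNS hω 1, LinearMap.mem_range_self _ 1⟩ = gnsVec hω x
  rw [gnsOp_apply, rmul_one]

theorem gnsRep_ultraCyclic (ξ : (gnsRep hω).D) :
    ∃ a : A₀, (gnsRep hω).π (ι a) (gnsCyclic hω) = (ξ : (gnsRep hω).H) := by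
  obtain ⟨_, a, rfl⟩ := ξ
  exact ⟨a, by rw [gnsRep_cyclic, gnsVec_ι]⟩

theorem gnsRep_inner (x : A) :
    Inner.inner ℂ (gnsCyclic hω : (gnsRep hω).H) ((gnsRep hω).π x (gnsCyclic hω)) = ω x := by
  rw [gnsRep_cyclic]
  change Inner.inner ℂ (toGNS hω 1) (gnsVec hω x) = ω x
  have h := hω.hermitian 1 1 (star x)
  simp only [star_star, star_one, rmul_one, one_lmul] at h
  rw [← inner_conj_symm, inner_gnsVec, rmul_one, h]
  rfl

end GNS

end

end QuasiStar

/-!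
The proof rests on a Radon–Nikodym correspondence for the GNS representation of a representable
functional `ω`. An operator `X` of the weak commutant yields the functional
`x ↦ ⟨ξ_ω, X π_ω(x) ξ_ω⟩`, and is determined by it.

* If `X` is positive, this functional is representable: the required bound is the Cauchy–Schwarz
  inequality for the form `⟨u, X v⟩` (`isRepresentable_operatorFunctional`).
* Every representable `ν ≤ ω` arises from some `X` in the weak commutant with `0 ≤ X ≤ 1`
  (`exists_isPositive_operatorFunctional_eq`). The inequality on squares makes `λ_ω(a) ↦ λ_ν(a)` a
  contraction `V`, and `X = V† V`. That `X` commutes weakly with `π_ω(x)` for every `x ∈ A`, and not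
  only for `x ∈ A₀`, follows from the density of `A₀`, as `λ_ω` and `λ_ν` are continuous.

Applying the first item to `1 - X` shows that the difference `ω - ν` is again representable, a fact
which is not clear from the definition since the bound required there does not pass to differences
(`IsRepresentable.sub`). This makes the classical argument work: an extreme point `ω` that dominates
`ν` is a convex combination of the normalizations of `ν` and `ω - ν`, and conversely the terms of a
convex combination equal to `ω` are dominated by `ω`, because representable functionals are
continuous and hence nonnegative on the closed cone `A⁺`.

Through the correspondence, purity says that the positive contractions in the weak commutant are
scalars. The weak commutant is a subspace that contains the identity and is stable under adjoints,
so it is then reduced to the scalars, and conversely.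
-/

namespace QuasiStar

open QuasiStarAlgebra ContinuousLinearMap

/-! ### Positive operators -/

/-- The Cauchy–Schwarz inequality for the semi-inner product `⟨u, X v⟩` of a positive operator. -/
theorem norm_inner_apply_le_of_isPositive {H : Type*} [NormedAddCommGroup H]
    [InnerProductSpace ℂ H] [CompleteSpace H] {X : H →L[ℂ] H} (hX : X.IsPositive) (u v : H) :
    ‖(Inner.inner ℂ u (X v) : ℂ)‖ ≤ Real.sqrt (Inner.inner ℂ u (X u) : ℂ).re *
      Real.sqrt (Inner.inner ℂ v (X v) : ℂ).re := by
  let c : PreInnerProductSpace.Core ℂ H :=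
    { inner := fun a b => Inner.inner ℂ a (X b)
      conj_inner_symm := fun a b => by
        rw [inner_conj_symm, hX.inner_left_eq_inner_right]
      re_inner_nonneg := fun a => hX.re_inner_nonneg_right a
      add_left := fun a b d => inner_add_left _ _ _
      smul_left := fun a b r => inner_smul_left _ _ _ }
  exact @InnerProductSpace.Core.norm_inner_le_norm ℂ H _ _ _ c u v

theorem isPositive_id_sub_of_re_inner_le {H : Type*} [NormedAddCommGroup H]
    [InnerProductSpace ℂ H] [CompleteSpace H] {X : H →L[ℂ] H} (hX : IsSelfAdjoint X)
    (h : ∀ v, RCLike.re (Inner.inner ℂ (X v) v : ℂ) ≤ ‖v‖ ^ 2) :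
    (ContinuousLinearMap.id ℂ H - X).IsPositive := by
  refine isPositive_def'.2 ⟨(IsSelfAdjoint.one (H →L[ℂ] H)).sub hX, fun v => ?_⟩
  rw [reApplyInnerSelf_apply, sub_apply, id_apply, inner_sub_left, map_sub, sub_nonneg,
    inner_self_eq_norm_sq]
  exact h v

/-- The shift `‖X‖ + 1` in place of `‖X‖` keeps the scalar invertible when `X = 0`. -/
theorem isPositive_id_sub_inv_smul {H : Type*} [NormedAddCommGroup H]
    [InnerProductSpace ℂ H] [CompleteSpace H] {X : H →L[ℂ] H} (hX : IsSelfAdjoint X) :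
    (ContinuousLinearMap.id ℂ H - ((‖X‖ + 1 : ℝ) : ℂ)⁻¹ • X).IsPositive := by
  have hc : IsSelfAdjoint ((‖X‖ + 1 : ℝ) : ℂ)⁻¹ := by
    rw [isSelfAdjoint_iff, star_inv₀, Complex.star_def, Complex.conj_ofReal]
  refine isPositive_id_sub_of_re_inner_le (hc.smul hX) fun v => ?_
  refine (Complex.re_le_norm _).trans ((norm_inner_le_norm _ _).trans ?_)
  have h : ‖X v‖ ≤ (‖X‖ + 1) * ‖v‖ := (X.le_opNorm v).trans (by gcongr; linarith)
  have hr : 0 < ‖X‖ + 1 := by positivity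
  rw [smul_apply, norm_smul, norm_inv, Complex.norm_of_nonneg hr.le, sq]
  gcongr
  rwa [inv_mul_le_iff₀ hr]

section

variable {A₀ A : Type u} [Ring A₀] [StarRing A₀] [Algebra ℂ A₀] [StarModule ℂ A₀]
  [AddCommGroup A] [Module ℂ A] [StarAddMonoid A] [StarModule ℂ A] [QuasiStarAlgebra A₀ A]

/-! ### Continuity for the topology of the representations -/

theorem StarRep.continuous_apply (ρ : StarRep A₀ A) (ξ : ρ.D) :
    @Continuous A ρ.H (tauRep A₀ A) _ (fun a => ρ.π a ξ) := by
  refine continuous_iInf_dom (i := ⟨ρ, ξ⟩) ?_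
  let : SeminormedAddCommGroup A := (ρ.seminorm ξ).toSeminormedAddCommGroup
  refine AddMonoidHomClass.continuous_of_bound
    (AddMonoidHom.mk' (fun a => ρ.π a ξ) fun a b => by simp) 1 fun a => ?_
  rw [one_mul]
  exact le_add_of_nonneg_right (norm_nonneg _)

variable {ω ν : A →ₗ[ℂ] ℂ} (hω : IsRepresentable A₀ ω)

theorem continuous_gnsVec : @Continuous A (GNSSpace hω) (tauRep A₀ A) _ (gnsVec hω) := by
  have h := (gnsRep hω).continuous_apply (gnsCyclic hω)
  simp only [gnsRep_cyclic] at h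
  exact h

theorem inner_one_gnsVec (x : A) : Inner.inner ℂ (toGNS hω 1) (gnsVec hω x) = ω x := by
  have h := gnsRep_inner hω x
  rw [gnsRep_cyclic] at h
  exact h

theorem IsRepresentable.nonneg_of_mem_positiveCone (hω : IsRepresentable A₀ ω) {a : A}
    (ha : a ∈ positiveCone A₀ A) : 0 ≤ ω a := by
  let := tauRep A₀ A
  have hc : Continuous fun a : A => ω a := by
    simp only [← inner_one_gnsVec hω]
    exact continuous_const.inner (continuous_gnsVec hω)
  refine closure_minimal (t := {a | 0 ≤ ω a}) ?_ (isClosed_le continuous_const hc) ha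
  rintro _ ⟨n, x, rfl⟩
  simp only [Set.mem_ofPred_eq, map_sum]
  exact Finset.sum_nonneg fun k _ => hω.nonneg (x k)

theorem star_mul_self_mem_positiveCone (a : A₀) : (ι (star a * a) : A) ∈ positiveCone A₀ A :=
  @subset_closure A (tauRep A₀ A) _ _ ⟨1, fun _ => a, by simp⟩

/-- By the bound `IsRepresentable.bounded` at `a = 1`, the value at the unit controls the whole functional. -/
theorem IsRepresentable.eq_zero (hω : IsRepresentable A₀ ω) (h : ω (ι (1 : A₀)) = 0) : ω = 0 := by
  ext x
  obtain ⟨γ, -, hγ⟩ := hω.bounded (star x)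
  have := hγ 1
  rw [star_star, rmul_one, star_one, one_mul, h] at this
  simpa using this

/-! ### Functionals given by positive operators in the weak commutant -/

/-- The weak commutant of the GNS representation in terms of the vectors `π(x) λ(a) = λ(x a)`. -/
theorem mem_weakCommutant_gnsRep {X : GNSSpace hω →L[ℂ] GNSSpace hω} :
    X ∈ (gnsRep hω).weakCommutant ↔ ∀ (x : A) (a b : A₀),
      Inner.inner ℂ (toGNS hω b) (X (gnsVec hω (rmul x a))) =
        Inner.inner ℂ (gnsVec hω (rmul (star x) b)) (X (toGNS hω a)) := by
  constructor
  · intro h x a b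
    have h' : Inner.inner ℂ (adjoint X (toGNS hω b)) (gnsOp hω x ⟨toGNS hω a, a, rfl⟩) =
        Inner.inner ℂ (gnsOp hω (star x) ⟨toGNS hω b, b, rfl⟩) (X (toGNS hω a)) :=
      h x ⟨toGNS hω a, a, rfl⟩ ⟨toGNS hω b, b, rfl⟩
    rwa [gnsOp_apply, gnsOp_apply, adjoint_inner_left] at h'
  · rintro h x ⟨_, a, rfl⟩ ⟨_, b, rfl⟩
    change Inner.inner ℂ (adjoint X (toGNS hω b)) (gnsOp hω x ⟨toGNS hω a, a, rfl⟩) =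
        Inner.inner ℂ (gnsOp hω (star x) ⟨toGNS hω b, b, rfl⟩) (X (toGNS hω a))
    rw [gnsOp_apply, gnsOp_apply, adjoint_inner_left, h]

/-- The functional `x ↦ ⟨ξ, X π(x) ξ⟩`, where `ξ` is the cyclic vector of the GNS representation,
so that `π(x) ξ = gnsVec x`. It is representable if `X` is positive and in the weak commutant. -/
noncomputable def operatorFunctional (X : GNSSpace hω →L[ℂ] GNSSpace hω) : A →ₗ[ℂ] ℂ :=
  (innerSL ℂ (toGNS hω 1)).toLinearMap ∘ₗ X.toLinearMap ∘ₗ gnsVec hω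

theorem operatorFunctional_apply (X : GNSSpace hω →L[ℂ] GNSSpace hω) (x : A) :
    operatorFunctional hω X x = Inner.inner ℂ (toGNS hω 1) (X (gnsVec hω x)) := rfl

theorem operatorFunctional_smul_id (c : ℂ) :
    operatorFunctional hω (c • ContinuousLinearMap.id ℂ (GNSSpace hω)) = c • ω := by
  ext x
  simp [operatorFunctional_apply, inner_one_gnsVec, inner_smul_right]

theorem operatorFunctional_id_sub (X : GNSSpace hω →L[ℂ] GNSSpace hω) :
    operatorFunctional hω (ContinuousLinearMap.id ℂ (GNSSpace hω) - X) =
      ω - operatorFunctional hω X := by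
  ext x
  simp [operatorFunctional_apply, inner_one_gnsVec, inner_sub_right]

theorem id_mem_weakCommutant :
    ContinuousLinearMap.id ℂ (GNSSpace hω) ∈ (gnsRep hω).weakCommutant := by
  refine (mem_weakCommutant_gnsRep hω).2 fun x a b => ?_
  rw [id_apply, id_apply, inner_gnsVec_rmul, ← inner_conj_symm, inner_gnsVec_rmul,
    hω.hermitian, star_star]
  simp

variable {X Y : GNSSpace hω →L[ℂ] GNSSpace hω}

theorem add_mem_weakCommutant (hX : X ∈ (gnsRep hω).weakCommutant)
    (hY : Y ∈ (gnsRep hω).weakCommutant) : X + Y ∈ (gnsRep hω).weakCommutant := by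
  rw [mem_weakCommutant_gnsRep] at *
  intro x a b
  simp only [add_apply, inner_add_right, hX x a b, hY x a b]

theorem smul_mem_weakCommutant (c : ℂ) (hX : X ∈ (gnsRep hω).weakCommutant) :
    c • X ∈ (gnsRep hω).weakCommutant := by
  rw [mem_weakCommutant_gnsRep] at *
  intro x a b
  simp only [smul_apply, inner_smul_right, hX x a b]

theorem smul_id_mem_weakCommutant (c : ℂ) :
    c • ContinuousLinearMap.id ℂ (GNSSpace hω) ∈ (gnsRep hω).weakCommutant :=
  smul_mem_weakCommutant hω c (id_mem_weakCommutant hω)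

theorem id_sub_mem_weakCommutant (hX : X ∈ (gnsRep hω).weakCommutant) :
    ContinuousLinearMap.id ℂ (GNSSpace hω) - X ∈ (gnsRep hω).weakCommutant := by
  have h := add_mem_weakCommutant hω (id_mem_weakCommutant hω) (smul_mem_weakCommutant hω (-1) hX)
  rwa [neg_one_smul, ← sub_eq_add_neg] at h

theorem adjoint_mem_weakCommutant (hX : X ∈ (gnsRep hω).weakCommutant) :
    adjoint X ∈ (gnsRep hω).weakCommutant := by
  rw [mem_weakCommutant_gnsRep] at *
  intro x a b
  have h := hX (star x) b a
  rw [star_star] at h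
  rw [adjoint_inner_right, adjoint_inner_right, ← inner_conj_symm, ← h, inner_conj_symm]

/-- The functional of `X` recovers all matrix coefficients of `X` between `λ(A₀)` and `λ(A)`. -/
theorem inner_toGNS_apply_gnsVec (hX : X ∈ (gnsRep hω).weakCommutant) (a : A₀) (x : A) :
    Inner.inner ℂ (toGNS hω a) (X (gnsVec hω x)) = operatorFunctional hω X (lmul (star a) x) := by
  rw [mem_weakCommutant_gnsRep] at hX
  have h₁ := hX x 1 a
  have h₂ := hX (lmul (star a) x) 1 1
  rw [rmul_one] at h₁ h₂
  rw [rmul_one, star_lmul, star_star] at h₂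
  rw [h₁, operatorFunctional_apply, h₂]

theorem inner_toGNS_apply_toGNS (hX : X ∈ (gnsRep hω).weakCommutant) (a b : A₀) :
    Inner.inner ℂ (toGNS hω a) (X (toGNS hω b)) = operatorFunctional hω X (ι (star a * b)) := by
  rw [← gnsVec_ι hω b, inner_toGNS_apply_gnsVec hω hX, lmul_ι]

theorem isRepresentable_operatorFunctional (hX : X ∈ (gnsRep hω).weakCommutant)
    (hp : X.IsPositive) : IsRepresentable A₀ (operatorFunctional hω X) := by
  have hherm (a b : A₀) (x : A) : operatorFunctional hω X (lmul (star b) (rmul (star x) a)) =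
      star (operatorFunctional hω X (lmul (star a) (rmul x b))) := by
    rw [← inner_toGNS_apply_gnsVec hω hX, ← inner_toGNS_apply_gnsVec hω hX,
      (mem_weakCommutant_gnsRep hω).1 hX, star_star, ← hp.inner_left_eq_inner_right,
      ← inner_conj_symm]
    rfl
  refine ⟨fun a => ?_, hherm, fun x => ?_⟩
  · rw [← inner_toGNS_apply_toGNS hω hX]
    exact hp.inner_nonneg_right _
  · refine ⟨Real.sqrt (Inner.inner ℂ (gnsVec hω x) (X (gnsVec hω x)) : ℂ).re + 1,
      by positivity, fun a => ?_⟩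
    have h := hherm a 1 x
    rw [star_one, one_lmul, rmul_one, ← inner_toGNS_apply_gnsVec hω hX] at h
    rw [h, norm_star, ← inner_toGNS_apply_toGNS hω hX]
    refine (norm_inner_apply_le_of_isPositive hp _ _).trans ?_
    rw [mul_comm]
    gcongr
    linarith

/-- Scaling `ω` is the case of a scalar operator. -/
theorem IsRepresentable.smul (hω : IsRepresentable A₀ ω) {c : ℂ} (hc : 0 ≤ c) :
    IsRepresentable A₀ (c • ω) := by
  rw [← operatorFunctional_smul_id hω]
  exact isRepresentable_operatorFunctional hω (smul_id_mem_weakCommutant hω c)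
    (isPositive_id.smul_of_nonneg hc)

/-- A Radon–Nikodym theorem. The contraction `V : λ_ω(a) ↦ λ_ν(a)` satisfies
`V λ_ω(x) = λ_ν(x)` even for `x ∈ A`, as both sides are continuous and `A₀` is dense; the operator
is `V† V`. -/
theorem exists_isPositive_operatorFunctional_eq (hν : IsRepresentable A₀ ν)
    (hdense : RepDense A₀ A) (h : FunctionalLE A₀ ν ω) :
    ∃ T : GNSSpace hω →L[ℂ] GNSSpace hω, T ∈ (gnsRep hω).weakCommutant ∧ T.IsPositive ∧
      (ContinuousLinearMap.id ℂ (GNSSpace hω) - T).IsPositive ∧ operatorFunctional hω T = ν := by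
  have hle (a : A₀) : ‖toGNS hν a‖ ≤ 1 * ‖toPre hω a‖ := by
    rw [one_mul, norm_toGNS, preGNS_norm]
    have := (Complex.nonneg_iff.mp (h _ (star_mul_self_mem_positiveCone a))).1
    rw [LinearMap.sub_apply, Complex.sub_re, sub_nonneg] at this
    exact Real.sqrt_le_sqrt this
  let f : PreGNS hω →L[ℂ] GNSSpace hν :=
    (toGNS hν ∘ₗ (toPre hω).symm.toLinearMap).mkContinuous 1 fun a => hle _
  let V : GNSSpace hω →L[ℂ] GNSSpace hν := f.extend UniformSpace.Completion.toComplL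
  have hV₀ (a : A₀) : V (toGNS hω a) = toGNS hν a :=
    ContinuousLinearMap.extend_eq f UniformSpace.Completion.denseRange_coe
      (UniformSpace.Completion.isUniformInducing_coe _) (toPre hω a)
  have hV (x : A) : V (gnsVec hω x) = gnsVec hν x := by
    let := tauRep A₀ A
    refine congrFun (Continuous.ext_on hdense (V.continuous.comp (continuous_gnsVec hω))
      (continuous_gnsVec hν) ?_) x
    rintro _ ⟨a, rfl⟩
    simp [gnsVec_ι, hV₀]
  have hnorm (v : GNSSpace hω) : ‖V v‖ ≤ ‖v‖ := by
    refine (denseRange_toGNS hω).induction_on (p := fun v => ‖V v‖ ≤ ‖v‖) v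
      (isClosed_le (by fun_prop) (by fun_prop)) fun a => ?_
    rw [hV₀]
    exact (hle a).trans_eq ((one_mul _).trans (UniformSpace.Completion.norm_coe _).symm)
  refine ⟨adjoint V ∘L V, ?_, ?_, ?_, ?_⟩
  · refine (mem_weakCommutant_gnsRep hω).2 fun x a b => ?_
    rw [comp_apply, comp_apply, adjoint_inner_right, adjoint_inner_right, hV, hV, hV₀, hV₀]
    exact (mem_weakCommutant_gnsRep hν).1 (id_mem_weakCommutant hν) x a b
  · exact isPositive_adjoint_comp_self V
  · refine isPositive_id_sub_of_re_inner_le (isPositive_adjoint_comp_self V).isSelfAdjoint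
      fun v => ?_
    rw [comp_apply, adjoint_inner_left, inner_self_eq_norm_sq]
    gcongr
    exact hnorm v
  · ext x
    rw [operatorFunctional_apply, comp_apply, adjoint_inner_right, hV, hV₀, inner_one_gnsVec]

/-- The difference is the functional of `1 - X` if `ν` is that of `X`. Density of
`A₀` enters in the bound for elements of `A` outside `A₀`. -/
theorem IsRepresentable.sub (hω : IsRepresentable A₀ ω) (hν : IsRepresentable A₀ ν)
    (hdense : RepDense A₀ A) (h : FunctionalLE A₀ ν ω) : IsRepresentable A₀ (ω - ν) := by
  obtain ⟨T, hT, -, hT', rfl⟩ := exists_isPositive_operatorFunctional_eq hω hν hdense h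
  rw [← operatorFunctional_id_sub]
  exact isRepresentable_operatorFunctional hω (id_sub_mem_weakCommutant hω hT) hT'

/-- An operator of the weak commutant is determined by its functional. -/
theorem eq_of_operatorFunctional_eq (hX : X ∈ (gnsRep hω).weakCommutant)
    (hY : Y ∈ (gnsRep hω).weakCommutant)
    (h : operatorFunctional hω X = operatorFunctional hω Y) : X = Y := by
  ext v
  refine (denseRange_toGNS hω).induction_on (p := fun v => X v = Y v) v
    (isClosed_eq (by fun_prop) (by fun_prop)) fun a => ?_
  refine ext_toGNS hω fun b => ?_
  rw [← inner_conj_symm, ← inner_conj_symm (Y _), inner_toGNS_apply_toGNS hω hX,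
    inner_toGNS_apply_toGNS hω hY, h]

/-! ### Extreme points, pure states and quasi-irreducibility -/

theorem mem_pureStates_of_mem_extremePoints (hdense : RepDense A₀ A) (hω : ω ∈ states A₀ A)
    (h : ω ∈ Set.extremePoints ℝ (repBall A₀ A)) : ω ∈ pureStates A₀ A := by
  refine ⟨hω, fun ν hν _ hle => ?_⟩
  have hμ := hω.1.1.sub hν.1 hdense hle
  obtain ⟨s, hs⟩ : ∃ s : ℝ, ν (ι (1 : A₀)) = s :=
    ⟨_, (Complex.conj_eq_iff_real.mp (by simpa using hν.1.conj_symm 1 1)).choose_spec⟩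
  have hμ1 : (ω - ν) (ι (1 : A₀)) = ((1 - s : ℝ) : ℂ) := by
    rw [LinearMap.sub_apply, hω.2, hs]; push_cast; rfl
  have hs0 : 0 ≤ s := by
    have := hν.1.nonneg 1
    rw [star_one, one_mul, hs] at this
    exact_mod_cast this
  have hs1 : s ≤ 1 := by
    have := hν.2
    rw [hs] at this
    exact_mod_cast this
  refine ⟨s, hs0, hs1, ?_⟩
  rcases hs0.eq_or_lt with rfl | hs0'
  · rw [Complex.ofReal_zero] at hs
    simpa using hν.1.eq_zero hs
  rcases hs1.eq_or_lt with rfl | hs1'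
  · rw [sub_self, Complex.ofReal_zero] at hμ1
    have := hμ.eq_zero hμ1
    rw [sub_eq_zero] at this
    simp [this]
  -- `ω` is the convex combination of the normalizations of `ν` and `ω - ν`.
  have hs1'' : 0 < 1 - s := sub_pos.2 hs1'
  have hsc : (s : ℂ) ≠ 0 := by exact_mod_cast hs0'.ne'
  have hsc' : ((1 - s : ℝ) : ℂ) ≠ 0 := by exact_mod_cast hs1''.ne'
  have key := (mem_extremePoints.1 h).2 (((s : ℂ)⁻¹) • ν)
    ⟨hν.1.smul (inv_nonneg.2 (by exact_mod_cast hs0)), by simp [hs, hsc]⟩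
    (((1 - s : ℝ) : ℂ)⁻¹ • (ω - ν))
    ⟨hμ.smul (inv_nonneg.2 (by exact_mod_cast hs1''.le)), by
      rw [LinearMap.smul_apply, hμ1, smul_eq_mul, inv_mul_cancel₀ hsc']⟩
    ⟨s, 1 - s, hs0', hs1'', by ring, by
      ext x
      simp only [LinearMap.add_apply, LinearMap.smul_apply, LinearMap.sub_apply, smul_eq_mul,
        Complex.real_smul]
      rw [mul_inv_cancel_left₀ hsc, mul_inv_cancel_left₀ hsc']
      ring⟩
  rw [← key.1, smul_inv_smul₀ hsc]

theorem mem_extremePoints_of_mem_pureStates (h : ω ∈ pureStates A₀ A) :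
    ω ∈ Set.extremePoints ℝ (repBall A₀ A) := by
  have hsmul (s : ℝ) (ν : A →ₗ[ℂ] ℂ) : s • ν = (s : ℂ) • ν := by
    ext x
    simp
  refine ⟨h.1.1, ?_⟩
  rintro ν hν μ hμ ⟨s, t, hs, ht, hst, hsum⟩
  rw [hsmul, hsmul] at hsum
  have hsν := hν.1.smul (c := (s : ℂ)) (by exact_mod_cast hs.le)
  have htμ := hμ.1.smul (c := (t : ℂ)) (by exact_mod_cast ht.le)
  have h1 := congrArg (fun φ : A →ₗ[ℂ] ℂ => φ (ι (1 : A₀))) hsum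
  simp only [LinearMap.add_apply, LinearMap.smul_apply, smul_eq_mul, h.1.2] at h1
  obtain ⟨hν1, hν2⟩ := Complex.le_def.1 hν.2
  have hμ1 := (Complex.le_def.1 hμ.2).1
  have h1re := congrArg Complex.re h1
  simp only [Complex.add_re, Complex.re_ofReal_mul, Complex.one_re] at h1re hν1 hμ1
  -- Both values at the unit are at most `1`, and their average is `1`.
  have hνe : ν (ι (1 : A₀)) = 1 := by
    refine Complex.ext ?_ hν2
    rw [Complex.one_re]
    nlinarith [mul_nonneg ht.le (sub_nonneg.2 hμ1)]
  have hμω : ω - (s : ℂ) • ν = (t : ℂ) • μ := by rw [← hsum, add_sub_cancel_left]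
  obtain ⟨r, -, -, hr⟩ := h.2 ((s : ℂ) • ν)
    ⟨hsν, by
      rw [LinearMap.smul_apply, hνe, smul_eq_mul, mul_one]
      exact_mod_cast (by linarith : s ≤ 1)⟩
    (fun a ha => by
      rw [sub_zero]
      exact hsν.nonneg_of_mem_positiveCone ha)
    (fun a ha => by
      rw [hμω]
      exact htμ.nonneg_of_mem_positiveCone ha)
  have hsr : (s : ℂ) = r := by
    have := congrArg (fun φ : A →ₗ[ℂ] ℂ => φ (ι (1 : A₀))) hr
    simpa [hνe, h.1.2] using this
  rw [← hsr] at hr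
  exact smul_right_injective _ (by exact_mod_cast hs.ne' : (s : ℂ) ≠ 0) hr

theorem quasiIrreducible_of_mem_pureStates (h : ω ∈ pureStates A₀ A) :
    (gnsRep h.1.1.1).QuasiIrreducible := by
  have hω := h.1.1.1
  -- The normalized operator is a positive contraction, so its functional is dominated by `ω`.
  have hpos (X : GNSSpace hω →L[ℂ] GNSSpace hω) (hX : X ∈ (gnsRep hω).weakCommutant)
      (hp : X.IsPositive) : ∃ c : ℂ, X = c • ContinuousLinearMap.id ℂ (GNSSpace hω) := by
    set r : ℂ := ((‖X‖ + 1 : ℝ) : ℂ) with hr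
    have hr0 : r ≠ 0 := by
      rw [hr]
      exact_mod_cast (by positivity : ‖X‖ + 1 ≠ 0)
    have hr1 : 0 ≤ r⁻¹ := inv_nonneg.2 (by rw [hr]; exact_mod_cast (by positivity))
    have hZ := smul_mem_weakCommutant hω r⁻¹ hX
    have hν := isRepresentable_operatorFunctional hω hZ (hp.smul_of_nonneg hr1)
    have hν' := isRepresentable_operatorFunctional hω (id_sub_mem_weakCommutant hω hZ)
      (isPositive_id_sub_inv_smul hp.isSelfAdjoint)
    rw [operatorFunctional_id_sub] at hν'
    obtain ⟨t, -, -, ht⟩ := h.2 _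
      ⟨hν, by
        have := hν'.nonneg 1
        rwa [star_one, one_mul, LinearMap.sub_apply, h.1.2, sub_nonneg] at this⟩
      (fun a ha => by
        rw [sub_zero]
        exact hν.nonneg_of_mem_positiveCone ha)
      (fun a ha => hν'.nonneg_of_mem_positiveCone ha)
    rw [← operatorFunctional_smul_id hω] at ht
    have := eq_of_operatorFunctional_eq hω hZ (smul_id_mem_weakCommutant hω t) ht
    exact ⟨r * t, by rw [mul_smul, ← this, smul_inv_smul₀ hr0]⟩
  -- A self-adjoint operator differs by a scalar from a multiple of a positive one.
  have hsa (X : GNSSpace hω →L[ℂ] GNSSpace hω) (hX : X ∈ (gnsRep hω).weakCommutant)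
      (hs : IsSelfAdjoint X) : ∃ c : ℂ, X = c • ContinuousLinearMap.id ℂ (GNSSpace hω) := by
    set r : ℂ := ((‖X‖ + 1 : ℝ) : ℂ) with hr
    have hr0 : r ≠ 0 := by
      rw [hr]
      exact_mod_cast (by positivity : ‖X‖ + 1 ≠ 0)
    obtain ⟨c, hc⟩ := hpos _ (id_sub_mem_weakCommutant hω (smul_mem_weakCommutant hω r⁻¹ hX))
      (isPositive_id_sub_inv_smul hs)
    refine ⟨r * (1 - c), ?_⟩
    rw [mul_smul, sub_smul, one_smul, ← hc, sub_sub_cancel, smul_inv_smul₀ hr0]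
  refine Set.Subset.antisymm (fun X hX => ?_) ?_
  · change GNSSpace hω →L[ℂ] GNSSpace hω at X
    have hX' := adjoint_mem_weakCommutant hω hX
    -- The real and imaginary parts of `X`, up to a real factor.
    obtain ⟨c, hc⟩ := hsa (X + adjoint X) (add_mem_weakCommutant hω hX hX')
      (IsSelfAdjoint.add_star_self X)
    obtain ⟨d, hd⟩ := hsa (Complex.I • (X + (-1 : ℂ) • adjoint X))
      (smul_mem_weakCommutant hω _ (add_mem_weakCommutant hω hX (smul_mem_weakCommutant hω _ hX')))
      (by
        rw [isSelfAdjoint_iff, star_smul, star_add, star_smul, star_eq_adjoint, star_eq_adjoint,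
          adjoint_adjoint]
        simp only [Complex.star_def, Complex.conj_I, map_neg, map_one]
        module)
    refine ⟨(1 / 2) * c - (Complex.I / 2) * d, ?_⟩
    change X = ((1 / 2) * c - (Complex.I / 2) * d) • ContinuousLinearMap.id ℂ (GNSSpace hω)
    rw [sub_smul, mul_smul, mul_smul, ← hc, ← hd, smul_smul, div_mul_eq_mul_div, Complex.I_mul_I]
    module
  · rintro _ ⟨c, rfl⟩
    exact smul_id_mem_weakCommutant hω c

theorem mem_pureStates_of_quasiIrreducible (hdense : RepDense A₀ A) (hω : ω ∈ states A₀ A)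
    (h : (gnsRep hω.1.1).QuasiIrreducible) : ω ∈ pureStates A₀ A := by
  refine ⟨hω, fun ν hν _ hle => ?_⟩
  obtain ⟨T, hT, -, -, rfl⟩ := exists_isPositive_operatorFunctional_eq hω.1.1 hν.1 hdense hle
  rw [h] at hT
  obtain ⟨c, hc⟩ := hT
  have hc' : T = c • ContinuousLinearMap.id ℂ (GNSSpace hω.1.1) := hc
  rw [hc', operatorFunctional_smul_id] at hν ⊢
  have h0 := hν.1.nonneg 1
  have h1 := hν.2
  rw [star_one, one_mul] at h0
  rw [LinearMap.smul_apply, hω.2, smul_eq_mul, mul_one] at h0 h1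
  lift c to ℝ using by simpa using (Complex.nonneg_iff.mp h0).2.symm
  exact ⟨c, by exact_mod_cast h0, by exact_mod_cast h1, rfl⟩

end

end QuasiStar

theorem mainTheorem1 {A₀ A : Type u} [Ring A₀] [StarRing A₀] [Algebra ℂ A₀] [StarModule ℂ A₀]
    [AddCommGroup A] [Module ℂ A] [StarAddMonoid A] [StarModule ℂ A]
    [QuasiStar.QuasiStarAlgebra A₀ A]
    {F : Type v} [Preorder F] (_L : QuasiStar.LocalStructure.{u, v, w} A₀ F)
    (_hfaithful : QuasiStar.RepFaithful A₀ A) (_hdense : QuasiStar.RepDense A₀ A)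
    (ω : A →ₗ[ℂ] ℂ) (hω : ω ∈ QuasiStar.states A₀ A) :
    List.TFAE
      [ω ∈ Set.extremePoints ℝ (QuasiStar.repBall A₀ A),
       ω ∈ QuasiStar.pureStates A₀ A,
       (QuasiStar.gnsRep hω.1.1).QuasiIrreducible] := by
  tfae_have 1 → 2 := QuasiStar.mem_pureStates_of_mem_extremePoints _hdense hω
  tfae_have 2 → 1 := QuasiStar.mem_extremePoints_of_mem_pureStates
  tfae_have 2 → 3 := QuasiStar.quasiIrreducible_of_mem_pureStates
  tfae_have 3 → 2 := QuasiStar.mem_pureStates_of_quasiIrreducible _hdense hω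
  tfae_finish
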